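/- Let $0<\alpha<1$. For $T>0$ let $$J^\alpha g(t)=\frac1{\Gamma(\alpha)}\int_0^t (t-s)^{\alpha-1}g(s)\,ds,\qquad g\in L^2(0,T),$$ let $H^\alpha(0,T)$ be the real Sobolev--Slobodeckij space with norm $\Big(\|u\|_{L^2(0,T)}^2+\int_0^T\!\int_0^T \frac{|u(t)-u(s)|^2}{|t-s|^{1+2\alpha}}\,ds\,dt\Big)^{1/2}$, and let $H_\alpha(0,T)$ be the closure in $H^\alpha(0,T)$ of $\{w\in C^1[0,T]: w(0)=0\}$. Let $\partial_t^\alpha=(J^\alpha)^{-1}$ be the inverse of $J^\alpha$ on $L^2(0,T)$; that is, $\partial_t^\alpha u=g$ on $(0,T)$ means that $u\in H_\alpha(0,T)$, $g\in L^2(0,T)$ and $J^\alpha g=u$ a.e. on $(0,T)$. Pointwise relations between functions below are understood for almost every $t$. (i) Let $a\in\mathbb R$, $t_0>0$ and $v:(0,\infty)\to\mathbb R$ be such that, for every $T>0$, $v-a\in H_\alpha(0,T)$, $\partial_t^\alpha(v-a)$ exists in $L^2(0,T)$, and $\partial_t^\alpha(v-a)(t)=0$ for $t_0<t<T$. Suppose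 that for each $p\in\mathbb N$ there are constants $C(p)>0$ and $R(p)>0$ such that $|v(t)|\le C(p)\,t^{-p}$ for $t>R(p)$. Then $a=0$ and $v(t)=0$ for $t>0$. (ii) In particular, let $a\in\mathbb R$, $t_0>0$ and $v:(0,\infty)\to\mathbb R$ be such that, for every $T>0$, $v-a\in H_\alpha(0,T)$, $\partial_t^\alpha(v-a)$ exists in $L^2(0,T)$, and $\partial_t^\alpha(v-a)(t)=0$ for $t_0<t<T$. If $v(t)=0$ for $t>t_0$, then $v(t)=0$ for $t>0$. -/

import Mathlib

open MeasureTheory Set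
open scoped ENNReal

/-- The Riemann-Liouville fractional integral
`J^α w (t) = (1 / Γ(α)) ∫_0^t (t - s)^(α - 1) w(s) ds`. -/
noncomputable def fracIntegral (α : ℝ) (w : ℝ → ℝ) (t : ℝ) : ℝ :=
  (1 / Real.Gamma α) * ∫ s in (0 : ℝ)..t, (t - s) ^ (α - 1) * w s

/-- The square of the Slobodeckij seminorm on `(0, T)`,
`∫_0^T ∫_0^T |u(t) - u(s)|² / |t - s|^(1 + 2α) ds dt`, as an extended nonnegative real. -/
noncomputable def slobodeckijSq (α T : ℝ) (u : ℝ → ℝ) : ℝ≥0∞ :=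
  ∫⁻ t in Ioo 0 T, ∫⁻ s in Ioo 0 T,
    ENNReal.ofReal (|u t - u s| ^ 2 / |t - s| ^ (1 + 2 * α))

/-- The norm of the Sobolev-Slobodeckij space `H^α(0, T)`, `0 < α < 1` (infinite if `u` is not
in that space). -/
noncomputable def sobolevNorm (α T : ℝ) (u : ℝ → ℝ) : ℝ≥0∞ :=
  (eLpNorm u 2 (volume.restrict (Ioo 0 T)) ^ 2 + slobodeckijSq α T u) ^ (1 / 2 : ℝ)

/-- The Sobolev-Slobodeckij space `H^α(0, T)`, `0 < α < 1`. Its elements are represented by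
functions on `ℝ` of which only the values almost everywhere on `(0, T)` matter. -/
def SobolevSpace (α T : ℝ) : Set (ℝ → ℝ) :=
  {u | MemLp u 2 (volume.restrict (Ioo 0 T)) ∧ sobolevNorm α T u < ∞}

/-- The functions `w ∈ C¹[0, T]` with `w(0) = 0`. -/
def C1Zero (T : ℝ) : Set (ℝ → ℝ) :=
  {w | ContDiffOn ℝ 1 w (Icc 0 T) ∧ w 0 = 0}

/-- The space `H_α(0, T)`: the closure in `H^α(0, T)` of `{w ∈ C¹[0, T] : w(0) = 0}`. -/
def FracHSpace (α T : ℝ) : Set (ℝ → ℝ) :=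
  {u | u ∈ SobolevSpace α T ∧
    ∀ ε : ℝ≥0∞, 0 < ε → ∃ w ∈ C1Zero T, sobolevNorm α T (u - w) < ε}

/-- `IsFracDeriv α T u g` says that `∂_t^α u = g` on `(0, T)`, where `∂_t^α = (J^α)⁻¹` is the
inverse of the operator `J^α` on `L²(0, T)`: `u` belongs to `H_α(0, T)`, and `g ∈ L²(0, T)` is
such that `J^α g = u` (almost everywhere on `(0, T)`). -/
structure IsFracDeriv (α T : ℝ) (u g : ℝ → ℝ) : Prop where
  mem_FracHSpace : u ∈ FracHSpace α T
  memLp : MemLp g 2 (volume.restrict (Ioo 0 T))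
  fracIntegral_eq : ∀ᵐ t ∂(volume.restrict (Ioo 0 T)), fracIntegral α g t = u t

/-- `FracDerivVanishesAfter α t₀ u` says that, for every `T > 0`, `u` belongs to the domain of
`∂_t^α` on `(0, T)`, and that `∂_t^α u (t) = 0` for (almost every) `t > t₀`. -/
def FracDerivVanishesAfter (α t₀ : ℝ) (u : ℝ → ℝ) : Prop :=
  ∀ T : ℝ, 0 < T → ∃ g : ℝ → ℝ, IsFracDeriv α T u g ∧
    ∀ᵐ t ∂(volume.restrict (Ioo 0 T)), t₀ < t → g t = 0

/-! Let `g` be the fractional derivative of `v - a`, supported in `(0, b)` with `b = t₀`. For `t >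
b`, pulling `t` out of `(t - s) ^ (α - 1)` gives `v t - a = t ^ (α - 1) / Γ(α) * K (1 / t)`, where
`K` is the kernel integral of `g`, analytic on `|x| < 1 / b`. Since `t ^ (α - 1) → 0`, `v → a` at
infinity, so decay forces `a = 0`. Rapid decay then makes `K` flat at `0` from the right, hence zero
near `0`. Its Taylor coefficients are moments of `g` times binomial coefficients of the negative
number `α - 1`, which never vanish; so all moments of `g` vanish, `g = 0` by Weierstrass
approximation, and `v = J^α g = 0`. The derivative is given separately on each `(0, T)`; the same
moment argument, with the identity theorem, shows that these derivatives agree on `(0, b)`. Part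
(ii) is the case of a function that is eventually zero. -/

/-! ### Power series of the kernel integral -/

/-- The kernel integral `∫_0^b (1 - x s)^β h(s) ds`, an analytic function of `x` near `0` whose
Taylor coefficients are multiples of the moments of `h`. -/
noncomputable def kernelIntegral (β b : ℝ) (h : ℝ → ℝ) (x : ℝ) : ℝ :=
  ∫ s in Ioo 0 b, (1 - x * s) ^ β * h s

/-- The Taylor coefficients of `kernelIntegral` at `0`. -/
noncomputable def kernelCoeff (β b : ℝ) (h : ℝ → ℝ) (k : ℕ) : ℝ :=
  Ring.choose β k * (-1) ^ k * ∫ s in Ioo 0 b, s ^ k * h s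

/-- Up to `k!` this is `β (β - 1) ⋯ (β - k + 1)`, whose factors are all negative. -/
theorem Ring.choose_ne_zero_of_neg {β : ℝ} (hβ : β < 0) (k : ℕ) : Ring.choose β k ≠ 0 := by
  have key : (descPochhammer ℤ k).smeval β ≠ 0 := by
    induction k with
    | zero => simp
    | succ n ih =>
      rw [descPochhammer_succ_right, Polynomial.smeval_mul]
      refine mul_ne_zero ih ?_
      have : (0 : ℝ) ≤ n := n.cast_nonneg
      simp only [Polynomial.smeval_sub, Polynomial.smeval_X, pow_one, Polynomial.smeval_natCast,
        pow_zero, nsmul_eq_mul, mul_one]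
      linarith
  intro h
  rw [Ring.descPochhammer_eq_factorial_smul_choose, h, smul_zero] at key
  exact key rfl

theorem summable_abs_choose_mul_pow (β : ℝ) {q : ℝ} (hq₀ : 0 ≤ q) (hq : q < 1) :
    Summable fun k : ℕ => |Ring.choose β k| * q ^ k := by
  have h := (binomialSeries ℝ β).summable_norm_mul_pow (r := NNReal.mk q hq₀)
    (lt_of_lt_of_le (by rw [← ENNReal.coe_one, ENNReal.coe_lt_coe]; exact hq) binomialSeries_radius_ge_one)
  refine h.congr fun k => ?_
  rw [binomialSeries, FormalMultilinearSeries.ofScalars_norm, Real.norm_eq_abs, NNReal.coe_mk]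

theorem hasSum_choose_mul_pow (β : ℝ) {y : ℝ} (hy : |y| < 1) :
    HasSum (fun k : ℕ => Ring.choose β k * y ^ k) ((1 + y) ^ β) := by
  have h := (Real.one_add_rpow_hasFPowerSeriesOnBall_zero (a := β)).hasSum (y := y)
    (by rw [← ENNReal.ofReal_one, Metric.eball_ofReal]; simpa using hy)
  simpa [binomialSeries, FormalMultilinearSeries.ofScalars_apply_eq, mul_comm] using h

theorem integrableOn_pow_mul {b : ℝ} {h : ℝ → ℝ} (hh : IntegrableOn h (Ioo 0 b)) (k : ℕ) :
    IntegrableOn (fun s => s ^ k * h s) (Ioo 0 b) := by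
  refine Integrable.bdd_mul (c := b ^ k) hh (by fun_prop) ?_
  filter_upwards [ae_restrict_mem measurableSet_Ioo] with s hs
  rw [norm_pow, Real.norm_of_nonneg hs.1.le]
  exact pow_le_pow_left₀ hs.1.le hs.2.le k

theorem integral_norm_pow_mul_le {b : ℝ} {h : ℝ → ℝ} (hh : IntegrableOn h (Ioo 0 b)) (k : ℕ) :
    ∫ s in Ioo 0 b, ‖s ^ k * h s‖ ≤ b ^ k * ∫ s in Ioo 0 b, ‖h s‖ := by
  rw [← integral_const_mul]
  refine setIntegral_mono_on (integrableOn_pow_mul hh k).norm (hh.norm.const_mul _)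
    measurableSet_Ioo fun s hs => ?_
  rw [norm_mul, norm_pow, Real.norm_of_nonneg hs.1.le]
  gcongr
  exacts [hs.1.le, hs.2.le]

theorem abs_kernelCoeff_le (β : ℝ) {b : ℝ} {h : ℝ → ℝ}
    (hh : IntegrableOn h (Ioo 0 b)) (k : ℕ) :
    |kernelCoeff β b h k| ≤ |Ring.choose β k| * b ^ k * ∫ s in Ioo 0 b, ‖h s‖ := by
  rw [kernelCoeff, abs_mul, abs_mul, abs_pow, abs_neg, abs_one, one_pow, mul_one, mul_assoc]
  gcongr
  exact (norm_integral_le_integral_norm _).trans (integral_norm_pow_mul_le hh k)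

/-- Binomial expansion under the integral: `|x| s ≤ |x| b < 1` makes the `L¹` norms of the terms
summable. -/
theorem hasSum_kernelCoeff (β : ℝ) {b : ℝ} (hb : 0 < b) {h : ℝ → ℝ}
    (hh : IntegrableOn h (Ioo 0 b)) {x : ℝ} (hx : |x| < b⁻¹) :
    HasSum (fun k => kernelCoeff β b h k * x ^ k) (kernelIntegral β b h x) := by
  have hxb : |x| * b < 1 := by rwa [← one_div, lt_div_iff₀ hb] at hx
  have hF : ∀ k : ℕ, IntegrableOn (fun s => Ring.choose β k * (-x) ^ k * (s ^ k * h s))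
      (Ioo 0 b) := fun k => (integrableOn_pow_mul hh k).const_mul _
  have hsum := hasSum_integral_of_summable_integral_norm hF (by
    refine Summable.of_nonneg_of_le (fun k => by positivity) (fun k => ?_)
      ((summable_abs_choose_mul_pow β (by positivity) hxb).mul_right (∫ s in Ioo 0 b, ‖h s‖))
    simp_rw [norm_mul (Ring.choose β k * (-x) ^ k)]
    rw [integral_const_mul, norm_mul, norm_pow, norm_neg, Real.norm_eq_abs, Real.norm_eq_abs,
      mul_pow, mul_assoc, mul_assoc, mul_assoc]
    gcongr
    exact integral_norm_pow_mul_le hh k)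
  convert! hsum using 1
  · funext k
    rw [integral_const_mul, kernelCoeff, neg_pow x]
    ring
  · refine setIntegral_congr_fun measurableSet_Ioo fun s hs => ?_
    have hxs : |-(x * s)| < 1 := by
      rw [abs_neg, abs_mul, abs_of_pos hs.1]
      exact (mul_le_mul_of_nonneg_left hs.2.le (abs_nonneg x)).trans_lt hxb
    have := ((hasSum_choose_mul_pow β hxs).mul_right (h s)).tsum_eq
    simp only [sub_eq_add_neg]
    rw [← this]
    refine tsum_congr fun k => ?_
    rw [neg_pow, mul_pow, neg_pow x]
    ring

theorem kernelIntegral_hasFPowerSeriesOnBall (β : ℝ) {b : ℝ} (hb : 0 < b) {h : ℝ → ℝ}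
    (hh : IntegrableOn h (Ioo 0 b)) :
    HasFPowerSeriesOnBall (kernelIntegral β b h)
      (FormalMultilinearSeries.ofScalars ℝ (kernelCoeff β b h)) 0 (ENNReal.ofReal b⁻¹) where
  r_le := by
    refine ENNReal.le_of_forall_nnreal_lt fun r hr => ?_
    have hr' : (r : ℝ) < b⁻¹ := by
      rw [← ENNReal.ofReal_coe_nnreal, ENNReal.ofReal_lt_ofReal_iff (by positivity)] at hr
      exact hr
    have hrb : b * r < 1 := by
      calc b * r < b * b⁻¹ := by gcongr
        _ = 1 := mul_inv_cancel₀ hb.ne'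
    refine FormalMultilinearSeries.le_radius_of_summable_norm _ ?_
    refine Summable.of_nonneg_of_le (fun k => by positivity) (fun k => ?_)
      ((summable_abs_choose_mul_pow β (by positivity) hrb).mul_right (∫ s in Ioo 0 b, ‖h s‖))
    rw [FormalMultilinearSeries.ofScalars_norm, Real.norm_eq_abs, mul_pow]
    calc |kernelCoeff β b h k| * (r : ℝ) ^ k
        ≤ (|Ring.choose β k| * b ^ k * ∫ s in Ioo 0 b, ‖h s‖) * (r : ℝ) ^ k := by
          gcongr; exact abs_kernelCoeff_le β hh k
      _ = _ := by ring
  r_pos := by simpa using hb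
  hasSum := by
    intro y hy
    rw [Metric.eball_ofReal] at hy
    have hy' : |y| < b⁻¹ := by simpa using hy
    simpa [FormalMultilinearSeries.ofScalars_apply_eq, mul_comm] using hasSum_kernelCoeff β hb hh hy'

theorem kernelIntegral_analyticOnNhd (β : ℝ) {b : ℝ} (hb : 0 < b) {h : ℝ → ℝ}
    (hh : IntegrableOn h (Ioo 0 b)) :
    AnalyticOnNhd ℝ (kernelIntegral β b h) (Metric.ball 0 b⁻¹) := by
  rw [← Metric.eball_ofReal]
  exact (kernelIntegral_hasFPowerSeriesOnBall β hb hh).analyticOnNhd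

/-! ### Vanishing moments and vanishing kernel integrals -/

/-- An integrable function on a bounded interval all of whose moments vanish is zero. -/
theorem ae_eq_zero_of_moments_eq_zero {b : ℝ} {h : ℝ → ℝ} (hh : IntegrableOn h (Ioo 0 b))
    (hm : ∀ k : ℕ, ∫ s in Ioo 0 b, s ^ k * h s = 0) :
    ∀ᵐ s ∂(volume.restrict (Ioo 0 b)), h s = 0 := by
  have hpoly : ∀ p : Polynomial ℝ, ∫ s in Ioo 0 b, p.eval s * h s = 0 := by
    intro p
    simp_rw [Polynomial.eval_eq_sum_range, Finset.sum_mul, mul_assoc]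
    rw [integral_finsetSum _ fun k _ => (integrableOn_pow_mul hh k).const_mul _]
    simp [integral_const_mul, hm]
  rw [ae_restrict_iff' measurableSet_Ioo]
  refine isOpen_Ioo.ae_eq_zero_of_integral_contDiff_smul_eq_zero hh.locallyIntegrableOn
    fun g hg _ hgs => ?_
  have hsupp : ∫ x, g x • h x = ∫ x in Ioo 0 b, g x * h x := by
    refine (setIntegral_eq_integral_of_forall_compl_eq_zero fun x hx => ?_).symm
    rw [image_eq_zero_of_notMem_tsupport fun hx' => hx (hgs hx'), zero_smul]
  have hgc := hg.continuous
  have hgi : IntegrableOn (fun s => g s * h s) (Ioo 0 b) := by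
    obtain ⟨M, hM⟩ := isCompact_Icc.exists_bound_of_continuousOn (hgc.continuousOn (s := Icc 0 b))
    refine Integrable.bdd_mul (c := M) hh hgc.aestronglyMeasurable ?_
    filter_upwards [ae_restrict_mem measurableSet_Ioo] with s hs
    exact hM s (Ioo_subset_Icc_self hs)
  rw [hsupp]
  set I := ∫ s in Ioo 0 b, ‖h s‖ with hI
  have hI0 : 0 ≤ I := integral_nonneg fun _ => norm_nonneg _
  have hle : ∀ ε : ℝ, 0 < ε → |∫ x in Ioo 0 b, g x * h x| ≤ ε * I := by
    intro ε hε
    -- Weierstrass: replacing the test function by a polynomial, against which `h` integrates to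
    -- `0`, costs at most `ε * I`.
    obtain ⟨p, hp⟩ := exists_polynomial_near_of_continuousOn 0 b g hgc.continuousOn ε hε
    have hpi : IntegrableOn (fun s => p.eval s * h s) (Ioo 0 b) := by
      obtain ⟨M, hM⟩ := isCompact_Icc.exists_bound_of_continuousOn
        (p.continuous.continuousOn (s := Icc 0 b))
      refine Integrable.bdd_mul (c := M) hh p.continuous.aestronglyMeasurable ?_
      filter_upwards [ae_restrict_mem measurableSet_Ioo] with s hs
      exact hM s (Ioo_subset_Icc_self hs)
    have hsub : ∫ x in Ioo 0 b, g x * h x = ∫ x in Ioo 0 b, (g x * h x - p.eval x * h x) := by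
      rw [integral_sub hgi hpi, hpoly p, sub_zero]
    rw [hsub, hI, ← integral_const_mul, ← Real.norm_eq_abs]
    refine norm_integral_le_of_norm_le (hh.norm.const_mul ε) ?_
    filter_upwards [ae_restrict_mem measurableSet_Ioo] with s hs
    rw [← sub_mul, norm_mul, Real.norm_eq_abs, abs_sub_comm]
    gcongr
    exact (hp s (Ioo_subset_Icc_self hs)).le
  refine abs_nonpos_iff.1 (le_of_forall_pos_le_add fun ε hε => ?_)
  -- `I + 1` rather than `I`, since `I` may be `0`.
  refine (hle (ε / (I + 1)) (by positivity)).trans ?_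
  rw [zero_add, div_mul_eq_mul_div, div_le_iff₀ (by positivity)]
  nlinarith

theorem ae_eq_zero_of_kernelIntegral_eventually_zero {β : ℝ} (hβ : β < 0) {b : ℝ} (hb : 0 < b)
    {h : ℝ → ℝ} (hh : IntegrableOn h (Ioo 0 b))
    (h0 : ∀ᶠ x in nhds 0, kernelIntegral β b h x = 0) :
    ∀ᵐ s ∂(volume.restrict (Ioo 0 b)), h s = 0 := by
  have hz := (kernelIntegral_hasFPowerSeriesOnBall β hb hh).hasFPowerSeriesAt.eq_zero_of_eventually
    h0
  rw [FormalMultilinearSeries.ofScalars_series_eq_zero] at hz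
  refine ae_eq_zero_of_moments_eq_zero hh fun k => ?_
  have := congrFun hz k
  simpa [kernelCoeff, Ring.choose_ne_zero_of_neg hβ k] using this

theorem kernelIntegral_inv_continuousOn (β : ℝ) {b : ℝ} (hb : 0 < b) {h : ℝ → ℝ}
    (hh : IntegrableOn h (Ioo 0 b)) :
    ContinuousOn (fun t => kernelIntegral β b h t⁻¹) (Ioi b) := by
  refine (kernelIntegral_analyticOnNhd β hb hh).continuousOn.comp
    (continuousOn_inv₀.mono fun t ht => (hb.trans ht).ne') fun t (ht : b < t) => ?_
  have ht0 := hb.trans ht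
  rw [mem_ball_zero_iff, Real.norm_of_nonneg (by positivity)]
  gcongr

/-- Continuity turns almost everywhere into everywhere, so the kernel integral vanishes on `(1 / T,
1 / b)`; the identity theorem on the ball of radius `1 / b` carries this to `0`. -/
theorem ae_eq_zero_of_kernelIntegral_inv_ae_zero {β : ℝ} (hβ : β < 0) {b T : ℝ} (hb : 0 < b)
    (hbT : b < T) {h : ℝ → ℝ} (hh : IntegrableOn h (Ioo 0 b))
    (h0 : ∀ᵐ t ∂(volume.restrict (Ioo b T)), kernelIntegral β b h t⁻¹ = 0) :
    ∀ᵐ s ∂(volume.restrict (Ioo 0 b)), h s = 0 := by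
  have hT := hb.trans hbT
  have hzero : EqOn (fun t => kernelIntegral β b h t⁻¹) (fun _ => 0) (Ioo b T) :=
    Measure.eqOn_open_of_ae_eq h0 isOpen_Ioo
      ((kernelIntegral_inv_continuousOn β hb hh).mono Ioo_subset_Ioi_self) continuousOn_const
  obtain ⟨x, hTx, hxb⟩ := exists_between (inv_strictAnti₀ hb hbT)
  have hx0 : 0 < x := (inv_pos.2 hT).trans hTx
  have hev : ∀ᶠ y in nhds x, kernelIntegral β b h y = 0 := by
    filter_upwards [Ioo_mem_nhds hTx hxb] with y hy
    have hy0 : 0 < y := (inv_pos.2 hT).trans hy.1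
    have := hzero (show y⁻¹ ∈ Ioo b T from
      ⟨(lt_inv_comm₀ hb hy0).2 hy.2, (inv_lt_comm₀ hy0 hT).2 hy.1⟩)
    simpa using this
  have hall := (kernelIntegral_analyticOnNhd β hb hh).eqOn_zero_of_preconnected_of_eventuallyEq_zero
    (convex_ball 0 _).isPreconnected
    (by rwa [mem_ball_zero_iff, Real.norm_of_nonneg hx0.le]) hev
  refine ae_eq_zero_of_kernelIntegral_eventually_zero hβ hb hh ?_
  filter_upwards [Metric.ball_mem_nhds (0 : ℝ) (inv_pos.2 hb)] with y hy using hall hy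

/-! ### Flat analytic functions and almost everywhere bounds -/

/-- A real function that is analytic at `0` and `O(x ^ p)` for every `p` on the right of `0`
vanishes near `0`. -/
theorem AnalyticAt.eventually_eq_zero_of_flat {f : ℝ → ℝ} (hf : AnalyticAt ℝ f 0)
    (hflat : ∀ p : ℕ, ∃ C : ℝ, ∀ᶠ x in nhdsWithin 0 (Ioi 0), |f x| ≤ C * x ^ p) :
    ∀ᶠ x in nhds 0, f x = 0 := by
  by_contra hne
  -- Otherwise `f x = x ^ n * g x` with `g 0 ≠ 0`, and flatness of order `n + 1` forces `g 0 = 0`.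
  obtain ⟨n, g, hg, hg0, hfg⟩ := hf.exists_eventuallyEq_pow_smul_nonzero_iff.2 hne
  obtain ⟨C, hC⟩ := hflat (n + 1)
  have hle : ∀ᶠ x in nhdsWithin 0 (Ioi 0), |g x| ≤ C * x := by
    filter_upwards [hC, hfg.filter_mono nhdsWithin_le_nhds, self_mem_nhdsWithin] with x hx hx' hx0
    have hx0 : 0 < x := hx0
    rw [hx', sub_zero, smul_eq_mul, abs_mul, abs_pow, abs_of_pos hx0] at hx
    have hp : 0 < x ^ n := by positivity
    refine le_of_mul_le_mul_left (hx.trans_eq ?_) hp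
    ring
  have hl : Filter.Tendsto (fun x => |g x|) (nhdsWithin 0 (Ioi 0)) (nhds |g 0|) :=
    hg.continuousAt.abs.tendsto.mono_left nhdsWithin_le_nhds
  have hr : Filter.Tendsto (fun x => C * x) (nhdsWithin 0 (Ioi 0)) (nhds (C * 0)) :=
    (Continuous.tendsto (by fun_prop) 0).mono_left nhdsWithin_le_nhds
  have := le_of_tendsto_of_tendsto hl hr hle
  rw [mul_zero] at this
  exact hg0 (abs_nonpos_iff.1 this)

theorem ContinuousOn.le_of_ae_le {f g : ℝ → ℝ} {U : Set ℝ} (hU : IsOpen U)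
    (hf : ContinuousOn f U) (hg : ContinuousOn g U) (h : ∀ᵐ t, t ∈ U → f t ≤ g t) :
    ∀ t ∈ U, f t ≤ g t := by
  have := Measure.eqOn_open_of_ae_eq (μ := volume) (f := fun t => max (f t) (g t)) (g := g)
    ((ae_restrict_iff' hU.measurableSet).2 (h.mono fun t ht htU => max_eq_right (ht htU))) hU
    (hf.sup hg) hg
  exact fun t ht => max_eq_right_iff.1 (this ht)

/-! ### Fractional derivatives that vanish after `b` -/

/-- Comparing power series needs only the integrability of `h` and `h'`, not that of their products
with the kernel. -/
theorem kernelIntegral_sub {β b : ℝ} (hb : 0 < b) {h h' : ℝ → ℝ}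
    (hh : IntegrableOn h (Ioo 0 b)) (hh' : IntegrableOn h' (Ioo 0 b)) {x : ℝ} (hx : |x| < b⁻¹) :
    kernelIntegral β b (h - h') x = kernelIntegral β b h x - kernelIntegral β b h' x := by
  refine (hasSum_kernelCoeff β hb (hh.sub hh') hx).unique ?_
  convert! (hasSum_kernelCoeff β hb hh hx).sub (hasSum_kernelCoeff β hb hh' hx) using 1
  funext k
  have : ∫ s in Ioo 0 b, s ^ k * (h - h') s =
      (∫ s in Ioo 0 b, s ^ k * h s) - ∫ s in Ioo 0 b, s ^ k * h' s := by
    rw [← integral_sub (integrableOn_pow_mul hh k) (integrableOn_pow_mul hh' k)]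
    simp_rw [Pi.sub_apply, mul_sub]
  rw [kernelCoeff, this, kernelCoeff, kernelCoeff]
  ring

theorem fracIntegral_eq_kernelIntegral (α : ℝ) {b T t : ℝ} {g : ℝ → ℝ} (hb : 0 < b)
    (hbt : b < t) (htT : t < T)
    (hg : ∀ᵐ s ∂(volume.restrict (Ioo 0 T)), b < s → g s = 0) :
    fracIntegral α g t = 1 / Real.Gamma α * t ^ (α - 1) * kernelIntegral (α - 1) b g t⁻¹ := by
  have ht := hb.trans hbt
  rw [fracIntegral, kernelIntegral, mul_assoc, ← integral_const_mul,
    intervalIntegral.integral_of_le ht.le, integral_Ioc_eq_integral_Ioo]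
  congr 1
  -- With `b` included, what is left of `(0, t)` lies strictly beyond `b`, where `g` vanishes.
  rw [← integral_Ioc_eq_integral_Ioo (y := b)]
  have hsub : Ioc 0 b ⊆ Ioo 0 t := fun s hs => ⟨hs.1, hs.2.trans_lt hbt⟩
  rw [setIntegral_eq_of_subset_of_ae_sdiff_eq_zero measurableSet_Ioo.nullMeasurableSet hsub]
  · refine setIntegral_congr_fun measurableSet_Ioc fun s hs => ?_
    have hst : t⁻¹ * s ≤ 1 := by
      rw [inv_mul_le_iff₀ ht, mul_one]
      exact hs.2.trans hbt.le
    rw [← mul_assoc, ← Real.mul_rpow ht.le (sub_nonneg.2 hst), mul_sub, mul_one,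
      mul_inv_cancel_left₀ ht.ne']
  · filter_upwards [(ae_restrict_iff' measurableSet_Ioo).1 hg] with s hs hs'
    rw [hs ⟨hs'.1.1, hs'.1.2.trans htT⟩ (not_le.1 fun h => hs'.2 ⟨hs'.1.1, h⟩), mul_zero]

theorem fracIntegral_eq_zero_of_ae_zero (α : ℝ) {T t : ℝ} {g : ℝ → ℝ} (ht : t ∈ Ioo 0 T)
    (hg : ∀ᵐ s ∂(volume.restrict (Ioo 0 T)), g s = 0) : fracIntegral α g t = 0 := by
  rw [fracIntegral, intervalIntegral.integral_zero_ae, mul_zero]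
  filter_upwards [(ae_restrict_iff' measurableSet_Ioo).1 hg] with s hs hs'
  rw [uIoc_of_le ht.1.le] at hs'
  rw [hs ⟨hs'.1, hs'.2.trans_lt ht.2⟩, mul_zero]

theorem IsFracDeriv.integrableOn {α T b : ℝ} {u g : ℝ → ℝ} (h : IsFracDeriv α T u g)
    (hbT : b ≤ T) : IntegrableOn g (Ioo 0 b) :=
  (show IntegrableOn g (Ioo 0 T) volume from h.memLp.integrable one_le_two).mono_set
    (Ioo_subset_Ioo_right hbT)

/-- If `∂_t^α u` vanishes after `b`, then the restrictions to `(0, b)` of the fractional derivatives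
of `u` on two intervals longer than `(0, b)` agree. -/
theorem IsFracDeriv.ae_eq {α b T T' : ℝ} {u g g' : ℝ → ℝ} (hα₀ : 0 < α) (hα₁ : α < 1)
    (hb : 0 < b) (hbT : b < T) (hTT' : T ≤ T') (hg : IsFracDeriv α T u g)
    (hg₀ : ∀ᵐ s ∂(volume.restrict (Ioo 0 T)), b < s → g s = 0)
    (hg' : IsFracDeriv α T' u g')
    (hg'₀ : ∀ᵐ s ∂(volume.restrict (Ioo 0 T')), b < s → g' s = 0) :
    ∀ᵐ s ∂(volume.restrict (Ioo 0 b)), g s = g' s := by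
  have hgi := hg.integrableOn hbT.le
  have hgi' := hg'.integrableOn (hbT.le.trans hTT')
  have hsub : ∀ᵐ s ∂(volume.restrict (Ioo 0 T)), b < s → (g - g') s = 0 := by
    filter_upwards [hg₀, ae_restrict_of_ae_restrict_of_subset (Ioo_subset_Ioo_right hTT') hg'₀]
      with s hs hs' hbs
    rw [Pi.sub_apply, hs hbs, hs' hbs, sub_zero]
  have hzero : ∀ᵐ t ∂(volume.restrict (Ioo b T)), kernelIntegral (α - 1) b (g - g') t⁻¹ = 0 := by
    have h1 := ae_restrict_of_ae_restrict_of_subset (Ioo_subset_Ioo_left hb.le)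
      hg.fracIntegral_eq
    have h2 := ae_restrict_of_ae_restrict_of_subset (Ioo_subset_Ioo hb.le hTT')
      hg'.fracIntegral_eq
    filter_upwards [h1, h2, ae_restrict_mem measurableSet_Ioo] with t ht ht' htm
    rw [fracIntegral_eq_kernelIntegral α hb htm.1 htm.2 hg₀] at ht
    rw [fracIntegral_eq_kernelIntegral α hb htm.1 (htm.2.trans_le hTT') hg'₀, ← ht] at ht'
    have hc : 1 / Real.Gamma α * t ^ (α - 1) ≠ 0 := by
      have := Real.Gamma_pos_of_pos hα₀
      have := hb.trans htm.1
      positivity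
    have heq := mul_left_cancel₀ hc ht'
    rw [kernelIntegral_sub hb hgi hgi' (by
      have := hb.trans htm.1
      rw [abs_of_pos (by positivity)]
      exact inv_strictAnti₀ hb htm.1), heq, sub_self]
  filter_upwards [ae_eq_zero_of_kernelIntegral_inv_ae_zero (by linarith) hb hbT (hgi.sub hgi')
    hzero] with s hs using sub_eq_zero.1 hs

theorem FracDerivVanishesAfter.exists_representation {α b : ℝ} {u : ℝ → ℝ} (hα₀ : 0 < α)
    (hα₁ : α < 1) (hb : 0 < b) (hu : FracDerivVanishesAfter α b u) :
    ∃ g : ℝ → ℝ, IntegrableOn g (Ioo 0 b) ∧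
      (∀ᵐ t, b < t → u t = 1 / Real.Gamma α * t ^ (α - 1) * kernelIntegral (α - 1) b g t⁻¹) ∧
      ((∀ᵐ s ∂(volume.restrict (Ioo 0 b)), g s = 0) → ∀ᵐ t, 0 < t → u t = 0) := by
  -- These intervals exhaust the half-line and all reach beyond `b`, so every `G n` agrees with `G
  -- 0` on `(0, b)`.
  choose G hG hG₀ using fun n : ℕ => hu (b + 1 + (n : ℝ)) (by positivity)
  have hbn : ∀ n : ℕ, b < b + 1 + n := fun n => by
    have : (0 : ℝ) ≤ n := n.cast_nonneg
    linarith
  have hagree : ∀ n : ℕ, ∀ᵐ s ∂(volume.restrict (Ioo 0 b)), G 0 s = G n s := fun n =>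
    (hG 0).ae_eq hα₀ hα₁ hb (hbn 0) (by simp) (hG₀ 0) (hG n) (hG₀ n)
  have hrep : ∀ n : ℕ, ∀ᵐ t, t ∈ Ioo 0 (b + 1 + n) → fracIntegral α (G n) t = u t := fun n =>
    (ae_restrict_iff' measurableSet_Ioo).1 (hG n).fracIntegral_eq
  refine ⟨G 0, (hG 0).integrableOn (hbn 0).le, ?_, fun h0 => ?_⟩
  · filter_upwards [ae_all_iff.2 hrep] with t ht hbt
    obtain ⟨n, hn⟩ := exists_nat_gt t
    have htn : t < b + 1 + n := by linarith
    rw [← ht n ⟨hb.trans hbt, htn⟩, fracIntegral_eq_kernelIntegral α hb hbt htn (hG₀ n)]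
    congr 1
    refine integral_congr_ae ?_
    filter_upwards [hagree n] with s hs
    rw [hs]
  · filter_upwards [ae_all_iff.2 hrep] with t ht ht0
    obtain ⟨n, hn⟩ := exists_nat_gt t
    have htn : t ∈ Ioo 0 (b + 1 + n) := ⟨ht0, by linarith⟩
    rw [← ht n htn]
    refine fracIntegral_eq_zero_of_ae_zero α htn ?_
    rw [ae_restrict_iff' measurableSet_Ioo]
    filter_upwards [(ae_restrict_iff' measurableSet_Ioo).1 h0,
      (ae_restrict_iff' measurableSet_Ioo).1 (hagree n),
      (ae_restrict_iff' measurableSet_Ioo).1 (hG₀ n), Measure.ae_ne volume b] with s h1 h2 h3 h4 hs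
    rcases lt_or_gt_of_ne h4 with hsb | hsb
    · rw [← h2 ⟨hs.1, hsb⟩, h1 ⟨hs.1, hsb⟩]
    · exact h3 hs hsb

/-! ### Rapid decay and conclusion -/

/-- A function of the form `a + t ^ β G(1 / t)`, with `β < 0` and `G` a kernel integral, which
decays faster than every power of `t` is zero. -/
theorem eq_zero_of_rapid_decay {β : ℝ} (hβ₀ : -1 < β) (hβ : β < 0) {a b c : ℝ} (hb : 0 < b)
    (hc : 0 < c) {g v : ℝ → ℝ} (hg : IntegrableOn g (Ioo 0 b))
    (hrep : ∀ᵐ t, b < t → v t - a = c * t ^ β * kernelIntegral β b g t⁻¹)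
    (hv : ∀ p : ℕ, ∃ C : ℝ, 0 < C ∧ ∃ R : ℝ, 0 < R ∧ ∀ᵐ t, R < t → |v t| ≤ C / t ^ p) :
    a = 0 ∧ ∀ᵐ s ∂(volume.restrict (Ioo 0 b)), g s = 0 := by
  have hcont : ContinuousOn (fun t => a + c * t ^ β * kernelIntegral β b g t⁻¹) (Ioi b) :=
    continuousOn_const.add ((continuousOn_const.mul fun t ht =>
      (Real.continuousAt_rpow_const t β (Or.inl (hb.trans ht).ne')).continuousWithinAt).mul
        (kernelIntegral_inv_continuousOn β hb hg))
  have hbound : ∀ p : ℕ, ∃ C : ℝ, 0 < C ∧ ∀ᶠ t in Filter.atTop,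
      |a + c * t ^ β * kernelIntegral β b g t⁻¹| ≤ C / t ^ p := by
    intro p
    obtain ⟨C, hC, R, hR, h⟩ := hv p
    refine ⟨C, hC, ?_⟩
    -- Both sides are continuous beyond `b`, so the bound holds at every point and can be used in
    -- limits.
    have hle := ContinuousOn.le_of_ae_le (isOpen_Ioi (a := max b R))
      (f := fun t => |a + c * t ^ β * kernelIntegral β b g t⁻¹|) (g := fun t => C / t ^ p)
      (hcont.abs.mono (Ioi_subset_Ioi (le_max_left _ _)))
      (continuousOn_const.div (by fun_prop) fun t ht =>
        (pow_pos (hb.trans ((le_max_left b R).trans_lt ht)) p).ne')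
      (by
        filter_upwards [hrep, h] with t h1 h2 ht
        rw [← h1 ((le_max_left b R).trans_lt ht), add_sub_cancel]
        exact h2 ((le_max_right b R).trans_lt ht))
    filter_upwards [Filter.eventually_gt_atTop (max b R)] with t ht using hle t ht
  have hK : AnalyticAt ℝ (kernelIntegral β b g) 0 :=
    kernelIntegral_analyticOnNhd β hb hg 0 (Metric.mem_ball_self (inv_pos.2 hb))
  have hlim : Filter.Tendsto (fun t => |a + c * t ^ β * kernelIntegral β b g t⁻¹|) Filter.atTop
      (nhds |a + c * 0 * kernelIntegral β b g 0|) := by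
    have hpow : Filter.Tendsto (fun t : ℝ => t ^ β) Filter.atTop (nhds 0) := by
      simpa using tendsto_rpow_neg_atTop (neg_pos.2 hβ)
    exact (((hpow.const_mul c).mul
      (hK.continuousAt.tendsto.comp tendsto_inv_atTop_zero)).const_add a).abs
  have ha : a = 0 := by
    obtain ⟨C, -, hC⟩ := hbound 1
    have hr : Filter.Tendsto (fun t : ℝ => C / t ^ 1) Filter.atTop (nhds 0) := by
      simpa using tendsto_const_nhds.div_atTop (Filter.tendsto_id (α := ℝ))
    have := le_of_tendsto_of_tendsto hlim hr hC
    rw [mul_zero, zero_mul, add_zero] at this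
    exact abs_nonpos_iff.1 this
  refine ⟨ha, ae_eq_zero_of_kernelIntegral_eventually_zero hβ hb hg
    (hK.eventually_eq_zero_of_flat fun p => ?_)⟩
  -- With `t = 1 / x`, the factor `t ^ β = x ^ (-β)` is at least `x` for `0 < x < 1`, as `-β ≤ 1`;
  -- dividing it out costs one power.
  obtain ⟨C, hC, h⟩ := hbound (p + 1)
  refine ⟨C / c, ?_⟩
  filter_upwards [tendsto_inv_nhdsGT_zero.eventually h, Ioo_mem_nhdsGT one_pos] with x hx hx01
  have hx0 := hx01.1
  rw [inv_inv, ha, zero_add, abs_mul, abs_mul, abs_of_pos hc,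
    abs_of_pos (Real.rpow_pos_of_pos (inv_pos.2 hx0) β), inv_pow, div_inv_eq_mul] at hx
  have hxβ : x ≤ x⁻¹ ^ β := by
    rw [Real.inv_rpow hx0.le, ← Real.rpow_neg hx0.le]
    simpa using Real.rpow_le_rpow_of_exponent_ge hx0 hx01.2.le (show -β ≤ 1 by linarith)
  have hmul : x * (c * |kernelIntegral β b g x|) ≤ x * (C * x ^ p) := by
    calc x * (c * |kernelIntegral β b g x|) ≤ x⁻¹ ^ β * (c * |kernelIntegral β b g x|) := by gcongr
      _ = c * x⁻¹ ^ β * |kernelIntegral β b g x| := by ring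
      _ ≤ C * x ^ (p + 1) := hx
      _ = x * (C * x ^ p) := by ring
  rw [div_mul_eq_mul_div, le_div_iff₀ hc, mul_comm]
  exact le_of_mul_le_mul_left hmul hx0

theorem proposition2 (α : ℝ) (hα₀ : 0 < α) (hα₁ : α < 1) :
    (∀ (a t₀ : ℝ) (v : ℝ → ℝ), 0 < t₀ →
      FracDerivVanishesAfter α t₀ (fun t => v t - a) →
      (∀ p : ℕ, ∃ C : ℝ, 0 < C ∧ ∃ R : ℝ, 0 < R ∧
        ∀ᵐ t ∂(volume : Measure ℝ), R < t → |v t| ≤ C / t ^ p) →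
      a = 0 ∧ ∀ᵐ t ∂(volume : Measure ℝ), 0 < t → v t = 0) ∧
    (∀ (a t₀ : ℝ) (v : ℝ → ℝ), 0 < t₀ →
      FracDerivVanishesAfter α t₀ (fun t => v t - a) →
      (∀ᵐ t ∂(volume : Measure ℝ), t₀ < t → v t = 0) →
      ∀ᵐ t ∂(volume : Measure ℝ), 0 < t → v t = 0) := by
  have decay : ∀ (a t₀ : ℝ) (v : ℝ → ℝ), 0 < t₀ →
      FracDerivVanishesAfter α t₀ (fun t => v t - a) →
      (∀ p : ℕ, ∃ C : ℝ, 0 < C ∧ ∃ R : ℝ, 0 < R ∧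
        ∀ᵐ t ∂(volume : Measure ℝ), R < t → |v t| ≤ C / t ^ p) →
      a = 0 ∧ ∀ᵐ t ∂(volume : Measure ℝ), 0 < t → v t = 0 := by
    intro a t₀ v ht₀ hfrac hv
    obtain ⟨g, hg, hrep, hzero⟩ := hfrac.exists_representation hα₀ hα₁ ht₀
    obtain ⟨ha, hg0⟩ := eq_zero_of_rapid_decay (by linarith) (by linarith) ht₀
      (one_div_pos.2 (Real.Gamma_pos_of_pos hα₀)) hg hrep hv
    refine ⟨ha, ?_⟩
    filter_upwards [hzero hg0] with t ht h0
    rw [← ht h0, ha, sub_zero]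
  refine ⟨decay, fun a t₀ v ht₀ hfrac hv => (decay a t₀ v ht₀ hfrac fun p => ?_).2⟩
  refine ⟨1, one_pos, t₀, ht₀, ?_⟩
  filter_upwards [hv] with t ht h
  have := ht₀.trans h
  rw [ht h, abs_zero]
  positivity
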